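/- Let $d \geq 1$ be an integer, $\mu \in \mathbb{R}$ and $\sigma > 0$. Suppose that the random vector $(X_1, \ldots, X_d)$ is multivariate Gaussian (its covariance matrix may be singular), with $X_i \sim \mathcal{N}(\mu, \sigma^2)$ for each $1 \leq i \leq d$. Then for every $x \in \mathbb{R}$ and $\varepsilon \geq 0$, $$ \mathbb{P}\Bigl( x < \max_{1 \leq i \leq d} X_i \leq x + \varepsilon \Bigr) \leq \frac{\varepsilon}{\sigma} \Bigl( \sqrt{2 \log d} + 1 \Bigr) $$ and $$ \mathbb{P}\Bigl( x < \max_{1 \leq i \leq d} |X_i - \mu| \leq x + \varepsilon \Bigr) \leq \frac{\varepsilon}{\sigma} \Bigl( \sqrt{2 \log (2d)} + 1 \Bigr). $$ -/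

import Mathlib

open MeasureTheory ProbabilityTheory

open scoped ENNReal

/-! After standardizing to `Y`, split according to the first maximizer `i`. Write `Y j = c j * Y i +
V j` with `V` independent of `Y i`; equal variances force `c j ≤ 1`, so the conditional probability
`G i z` that `i` is the first maximizer given `Y i = z` increases with `z`
(`HasGaussianLaw.exists_monotone_density_argmaxSet`). Hence the maximum has density `G * φ`, where
`φ` is the standard normal density and `G = ∑ i, G i` is monotone, at most `n`, and of Gaussian mass
at most one. `mul_gaussianPDFReal_le_of_monotone` bounds such a density. Absolute values reduce to
the `2d` variables `±(X i - μ)`. -/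

/-! ### Gaussian tails and monotone densities -/

lemma hasDerivAt_gaussianPDFReal_zero_one (t : ℝ) :
    HasDerivAt (gaussianPDFReal 0 1) (-t * gaussianPDFReal 0 1 t) t := by
  have h : HasDerivAt (fun y : ℝ => -(y - 0) ^ 2 / (2 * ((1 : NNReal) : ℝ))) (-t) t := by
    have := ((((hasDerivAt_id t).sub_const 0).pow 2).neg).div_const (2 * ((1 : NNReal) : ℝ))
    convert! this using 1
    simp
    ring
  have h2 := (h.exp).const_mul (Real.sqrt (2 * Real.pi * ((1 : NNReal) : ℝ)))⁻¹
  rw [gaussianPDFReal_def]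
  convert! h2 using 1
  ring

lemma gaussianPDFReal_zero_one_le_exp (z : ℝ) :
    gaussianPDFReal 0 1 z ≤ Real.exp (-z ^ 2 / 2) := by
  simp only [gaussianPDFReal, sub_zero, NNReal.coe_one, mul_one]
  refine mul_le_of_le_one_left (Real.exp_pos _).le (inv_le_one_of_one_le₀ ?_)
  rw [Real.one_le_sqrt]
  linarith [Real.two_le_pi]

lemma measureReal_Ioi_gaussianReal (z : ℝ) :
    (gaussianReal 0 1).real (Set.Ioi z) = ∫ t in Set.Ioi z, gaussianPDFReal 0 1 t := by
  rw [measureReal_def, gaussianReal_apply_eq_integral 0 one_ne_zero,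
    ENNReal.toReal_ofReal (integral_nonneg fun t => gaussianPDFReal_nonneg 0 1 t)]

/-- A lower bound of Mills ratio type for the tail of the standard Gaussian distribution. -/
lemma gaussianPDFReal_le_mul_measureReal_Ioi_of_nonneg {z : ℝ} (hz : 0 ≤ z) :
    gaussianPDFReal 0 1 z ≤ (z + 1) * (gaussianReal 0 1).real (Set.Ioi z) := by
  -- `f` vanishes at infinity and `f' ≤ φ` on `t ≥ 0`, since `t ^ 2 + t + 1 ≤ (t + 1) ^ 2`;
  -- integrating over `(z, ∞)` gives `φ z / (z + 1)` as a lower bound for the tail.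
  set f : ℝ → ℝ := fun t => -(gaussianPDFReal 0 1 t / (t + 1)) with hf
  set f' : ℝ → ℝ := fun t => gaussianPDFReal 0 1 t * ((t ^ 2 + t + 1) / (t + 1) ^ 2) with hf'
  have hpos : ∀ t : ℝ, 0 ≤ gaussianPDFReal 0 1 t := gaussianPDFReal_nonneg 0 1
  have hderiv : ∀ t ∈ Set.Ici z, HasDerivAt f (f' t) t := by
    intro t ht
    have ht1 : t + 1 ≠ 0 := by have : z ≤ t := ht; linarith
    convert! (((hasDerivAt_gaussianPDFReal_zero_one t).div
      ((hasDerivAt_id t).add_const 1) ht1).neg) using 1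
    simp only [hf', id]
    field_simp
    ring
  have hle : ∀ t ∈ Set.Ioi z, f' t ≤ gaussianPDFReal 0 1 t := by
    intro t ht
    have ht0 : 0 ≤ t := hz.trans (le_of_lt ht)
    refine mul_le_of_le_one_right (hpos t) ((div_le_one (by positivity)).2 ?_)
    nlinarith
  have hnn : ∀ t ∈ Set.Ioi z, 0 ≤ f' t := by
    intro t ht
    have ht0 : 0 ≤ t := hz.trans (le_of_lt ht)
    exact mul_nonneg (hpos t) (by positivity)
  have hlim : Filter.Tendsto f Filter.atTop (nhds 0) := by
    have h1 : Filter.Tendsto (fun t : ℝ => (t + 1)⁻¹) Filter.atTop (nhds 0) :=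
      tendsto_inv_atTop_zero.comp (Filter.tendsto_atTop_add_const_right _ 1 Filter.tendsto_id)
    have h2 : Filter.Tendsto (fun t : ℝ => gaussianPDFReal 0 1 t / (t + 1)) Filter.atTop
        (nhds 0) := by
      refine tendsto_of_tendsto_of_tendsto_of_le_of_le' tendsto_const_nhds h1 ?_ ?_
      · filter_upwards [Filter.eventually_ge_atTop 0] with t ht
        exact div_nonneg (hpos t) (by linarith)
      · filter_upwards [Filter.eventually_ge_atTop 0] with t ht
        rw [div_eq_mul_inv]
        refine mul_le_of_le_one_left (by positivity) ?_
        refine (gaussianPDFReal_zero_one_le_exp t).trans (Real.exp_le_one_iff.2 ?_)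
        nlinarith [sq_nonneg t]
    simpa [hf] using h2.neg
  have hint : IntegrableOn f' (Set.Ioi z) :=
    integrableOn_Ioi_deriv_of_nonneg' hderiv hnn hlim
  have hval : ∫ t in Set.Ioi z, f' t = 0 - f z :=
    integral_Ioi_of_hasDerivAt_of_tendsto' hderiv hint hlim
  have hmono : ∫ t in Set.Ioi z, f' t ≤ ∫ t in Set.Ioi z, gaussianPDFReal 0 1 t :=
    setIntegral_mono_on hint (integrable_gaussianPDFReal 0 1).integrableOn measurableSet_Ioi hle
  rw [measureReal_Ioi_gaussianReal]
  rw [hval] at hmono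
  simp only [hf, sub_neg_eq_add, zero_add] at hmono
  rw [div_le_iff₀ (by linarith)] at hmono
  linarith

lemma gaussianPDFReal_le_mul_measureReal_Ioi (z : ℝ) :
    gaussianPDFReal 0 1 z ≤ (max z 0 + 1) * (gaussianReal 0 1).real (Set.Ioi z) := by
  rcases le_total 0 z with hz | hz
  · rw [max_eq_left hz]
    exact gaussianPDFReal_le_mul_measureReal_Ioi_of_nonneg hz
  · rw [max_eq_right hz]
    calc gaussianPDFReal 0 1 z ≤ gaussianPDFReal 0 1 0 := by
          simp only [gaussianPDFReal, sub_zero, NNReal.coe_one, mul_one]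
          refine mul_le_mul_of_nonneg_left (Real.exp_le_exp.2 ?_) (by positivity)
          nlinarith [sq_nonneg z]
      _ ≤ (0 + 1) * (gaussianReal 0 1).real (Set.Ioi 0) :=
          gaussianPDFReal_le_mul_measureReal_Ioi_of_nonneg le_rfl
      _ ≤ _ := by
          gcongr
          exact measure_ne_top _ _

/-- A monotone density with respect to the standard Gaussian measure, bounded by `n` and of total
mass at most one, yields a Lebesgue density bounded by `√(2 log n) + 1`. -/
lemma mul_gaussianPDFReal_le_of_monotone {G : ℝ → ℝ≥0∞} (hG : Monotone G) {n : ℕ} (hn : n ≠ 0)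
    (hGn : ∀ z, G z ≤ n) (hG1 : ∫⁻ z, G z ∂(gaussianReal 0 1) ≤ 1) (z : ℝ) :
    (G z).toReal * gaussianPDFReal 0 1 z ≤ Real.sqrt (2 * Real.log n) + 1 := by
  have hg : (G z).toReal ≤ n := by
    simpa using ENNReal.toReal_mono (ENNReal.natCast_ne_top n) (hGn z)
  have hT : (G z).toReal * (gaussianReal 0 1).real (Set.Ioi z) ≤ 1 := by
    have h : G z * gaussianReal 0 1 (Set.Ioi z) ≤ 1 := by
      calc G z * gaussianReal 0 1 (Set.Ioi z) = ∫⁻ _ in Set.Ioi z, G z ∂(gaussianReal 0 1) := by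
            simp
        _ ≤ ∫⁻ t in Set.Ioi z, G t ∂(gaussianReal 0 1) :=
            setLIntegral_mono' measurableSet_Ioi fun t ht => hG (le_of_lt ht)
        _ ≤ ∫⁻ t, G t ∂(gaussianReal 0 1) := setLIntegral_le_lintegral _ _
        _ ≤ 1 := hG1
    simpa [measureReal_def] using ENNReal.toReal_mono ENNReal.one_ne_top h
  have hpos := gaussianPDFReal_nonneg 0 1 z
  have hsq : 0 ≤ Real.sqrt (2 * Real.log n) := Real.sqrt_nonneg _
  -- Below the threshold, monotonicity (`hT`) and the Mills bound suffice; above it, `exp (-z ^ 2 /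
  -- 2)` is already less than `1 / n`.
  rcases le_or_gt z (Real.sqrt (2 * Real.log n)) with h | h
  · calc (G z).toReal * gaussianPDFReal 0 1 z
        ≤ (G z).toReal * ((max z 0 + 1) * (gaussianReal 0 1).real (Set.Ioi z)) := by
          gcongr
          exact gaussianPDFReal_le_mul_measureReal_Ioi z
      _ = (max z 0 + 1) * ((G z).toReal * (gaussianReal 0 1).real (Set.Ioi z)) := by ring
      _ ≤ (max z 0 + 1) * 1 := by gcongr
      _ ≤ _ := by
          rw [mul_one]
          gcongr
          exact max_le h hsq
  · have hn0 : (0 : ℝ) < n := by positivity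
    have hz : 2 * Real.log n < z ^ 2 := by
      rwa [← Real.sqrt_lt' (hsq.trans_lt h)]
    calc (G z).toReal * gaussianPDFReal 0 1 z
        ≤ n * Real.exp (-Real.log n) := by
          gcongr
          refine (gaussianPDFReal_zero_one_le_exp z).trans (Real.exp_le_exp.2 ?_)
          linarith
      _ = 1 := by
          rw [Real.exp_neg, Real.exp_log hn0, mul_inv_cancel₀ hn0.ne']
      _ ≤ _ := by linarith

lemma setLIntegral_Ioc_gaussianReal_le_of_monotone {G : ℝ → ℝ≥0∞} (hG : Monotone G) {n : ℕ}
    (hn : n ≠ 0) (hGn : ∀ z, G z ≤ n) (hG1 : ∫⁻ z, G z ∂(gaussianReal 0 1) ≤ 1) (a b : ℝ) :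
    ∫⁻ z in Set.Ioc a b, G z ∂(gaussianReal 0 1)
      ≤ ENNReal.ofReal (Real.sqrt (2 * Real.log n) + 1) * ENNReal.ofReal (b - a) := by
  rw [gaussianReal_of_var_ne_zero 0 one_ne_zero,
    setLIntegral_withDensity_eq_setLIntegral_mul _ (measurable_gaussianPDF 0 1) hG.measurable
      measurableSet_Ioc]
  calc ∫⁻ z in Set.Ioc a b, (gaussianPDF 0 1 * G) z
      ≤ ∫⁻ _ in Set.Ioc a b, ENNReal.ofReal (Real.sqrt (2 * Real.log n) + 1) := by
        refine lintegral_mono fun z => ?_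
        have hz : G z ≠ ∞ := ne_top_of_le_ne_top (ENNReal.natCast_ne_top n) (hGn z)
        rw [Pi.mul_apply, mul_comm, gaussianPDF, ← ENNReal.ofReal_toReal hz,
          ← ENNReal.ofReal_mul ENNReal.toReal_nonneg]
        exact ENNReal.ofReal_le_ofReal (mul_gaussianPDFReal_le_of_monotone hG hn hGn hG1 z)
    _ = _ := by simp

/-! ### First maximizers -/

section Argmax

variable {ι : Type*} [LinearOrder ι]

/-- The set of points where `i` is the first index at which the maximum is attained. -/
def argmaxSet (i : ι) : Set (ι → ℝ) := {y | ∀ j, (j < i → y j < y i) ∧ y j ≤ y i}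

lemma pairwise_disjoint_argmaxSet :
    Pairwise (Function.onFun Disjoint (argmaxSet : ι → Set (ι → ℝ))) := by
  intro i j hij
  refine Set.disjoint_left.2 fun y hi hj => ?_
  rcases lt_or_gt_of_ne hij with h | h
  · exact absurd ((hj i).1 h) (not_lt.2 (hi j).2)
  · exact absurd ((hi j).1 h) (not_lt.2 (hj i).2)

variable [Fintype ι]

lemma measurableSet_argmaxSet (i : ι) : MeasurableSet (argmaxSet i) := by
  simp only [argmaxSet, Set.ofPred_forall, Set.ofPred_and]
  refine MeasurableSet.iInter fun j => MeasurableSet.inter ?_ ?_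
  · by_cases h : j < i
    · simpa [h] using measurableSet_lt (measurable_pi_apply (X := fun _ : ι => ℝ) j)
        (measurable_pi_apply i)
    · simp [h]
  · exact measurableSet_le (measurable_pi_apply j) (measurable_pi_apply i)

lemma exists_mem_argmaxSet [Nonempty ι] (y : ι → ℝ) : ∃ i, y ∈ argmaxSet i := by
  obtain ⟨i₀, hi₀⟩ := Finite.exists_max y
  obtain ⟨i, hi, hmin⟩ := Set.exists_min_image {i | ∀ j, y j ≤ y i} id (Set.toFinite _)
    ⟨i₀, hi₀⟩
  refine ⟨i, fun j => ⟨fun hj => lt_of_le_of_ne (hi j) fun h => ?_, hi j⟩⟩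
  exact absurd (hmin j fun k => h ▸ hi k) (not_le.2 hj)

end Argmax

/-! ### Regression on one coordinate -/

section Density

variable {Ω ι : Type*} [MeasurableSpace Ω] {P : Measure Ω} [IsProbabilityMeasure P]
  {Y : ι → Ω → ℝ}

/-- `Var (Y j - Y i) = 2 - 2 cov` is nonnegative. -/
lemma covariance_le_one_of_hasLaw_gaussianReal (hY : ∀ i, HasLaw (Y i) (gaussianReal 0 1) P)
    (i j : ι) : cov[Y j, Y i; P] ≤ 1 := by
  have hL : ∀ k, MemLp (Y k) 2 P := fun k => (hY k).hasGaussianLaw.memLp_two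
  have hv : ∀ k, Var[Y k; P] = 1 := fun k => by
    rw [(hY k).variance_eq, variance_id_gaussianReal]; simp
  have h := variance_sub (hL j) (hL i)
  rw [hv, hv] at h
  linarith [variance_nonneg (Y j - Y i) P]

variable [Fintype ι]

/-- Regression of a Gaussian family on one coordinate. -/
lemma HasGaussianLaw.indepFun_sub_covariance_mul (hX : HasGaussianLaw (fun ω i => Y i ω) P)
    (hY : ∀ i, HasLaw (Y i) (gaussianReal 0 1) P) (i : ι) :
    IndepFun (Y i) (fun ω j => Y j ω - cov[Y j, Y i; P] * Y i ω) P := by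
  have hL : ∀ k, MemLp (Y k) 2 P := fun k => (hY k).hasGaussianLaw.memLp_two
  have hv : Var[Y i; P] = 1 := by rw [(hY i).variance_eq, variance_id_gaussianReal]; simp
  let c : ι → ℝ := fun j => cov[Y j, Y i; P]
  let L : (ι → ℝ) →L[ℝ] ((Unit → ℝ) × (ι → ℝ)) :=
    (ContinuousLinearMap.pi fun _ => ContinuousLinearMap.proj i).prod
      (ContinuousLinearMap.pi fun j => ContinuousLinearMap.proj j
        - c j • ContinuousLinearMap.proj i)
  have hG : HasGaussianLaw (fun ω => (fun _ : Unit => Y i ω, fun j => Y j ω - c j * Y i ω)) P :=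
    hX.map_fun L
  have hind := HasGaussianLaw.indepFun_of_covariance_eval (X := fun (_ : Unit) => Y i)
    (Y := fun j ω => Y j ω - c j * Y i ω) hG fun _ j => by
      have := covariance_fun_sub_left (hL j) ((hL i).const_mul (c j)) (hL i)
      rw [covariance_comm, this, covariance_const_mul_left, covariance_self (hL i).aemeasurable,
        hv, mul_one, sub_self]
  exact hind.comp (measurable_pi_apply ()) measurable_id

variable [LinearOrder ι]

/-- Where `i` is the first maximizer, the law of `Y i` has a monotone density with respect to the
standard Gaussian measure. -/
lemma HasGaussianLaw.exists_monotone_density_argmaxSet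
    (hX : HasGaussianLaw (fun ω i => Y i ω) P)
    (hY : ∀ i, HasLaw (Y i) (gaussianReal 0 1) P) (i : ι) :
    ∃ G : ℝ → ℝ≥0∞, Monotone G ∧ (∀ z, G z ≤ 1) ∧ ∀ A : Set ℝ, MeasurableSet A →
      P {ω | Y i ω ∈ A ∧ (fun j => Y j ω) ∈ argmaxSet i} = ∫⁻ z in A, G z ∂(gaussianReal 0 1) := by
  let c : ι → ℝ := fun j => cov[Y j, Y i; P]
  have hc : ∀ j, c j ≤ 1 := covariance_le_one_of_hasLaw_gaussianReal hY i
  have hci : c i = 1 := by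
    simp only [c]
    rw [covariance_self (hY i).aemeasurable, (hY i).variance_eq, variance_id_gaussianReal]
    simp
  let V : Ω → ι → ℝ := fun ω j => Y j ω - c j * Y i ω
  have hind : IndepFun (Y i) V P := HasGaussianLaw.indepFun_sub_covariance_mul hX hY i
  have hYm : ∀ j, AEMeasurable (Y j) P := fun j => (hY j).aemeasurable
  have hV : AEMeasurable V P :=
    aemeasurable_pi_lambda _ fun j => (hYm j).sub ((hYm i).const_mul (c j))
  have : IsProbabilityMeasure (P.map V) := Measure.isProbabilityMeasure_map hV
  have hmap : P.map (fun ω => (Y i ω, V ω)) = (gaussianReal 0 1).prod (P.map V) := by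
    rw [(indepFun_iff_map_prod_eq_prod_map_map (hYm i) hV).1 hind, (hY i).map_eq]
  -- `argmaxSet i` in the independent coordinates `(Y i, V)`.
  let S : Set (ℝ × (ι → ℝ)) :=
    {p | ∀ j, (j < i → p.2 j + c j * p.1 < p.1) ∧ p.2 j + c j * p.1 ≤ p.1}
  have hS : MeasurableSet S := by
    simp only [S, Set.ofPred_forall, Set.ofPred_and]
    refine MeasurableSet.iInter fun j => MeasurableSet.inter ?_ ?_
    · by_cases h : j < i
      · simpa [h] using measurableSet_lt (f := fun p : ℝ × (ι → ℝ) => p.2 j + c j * p.1)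
          (g := fun p => p.1) (by fun_prop) (by fun_prop)
      · simp [h]
    · exact measurableSet_le (by fun_prop) (by fun_prop)
  refine ⟨fun z => P.map V (Prod.mk z ⁻¹' S), fun z z' hz => measure_mono fun v hv j => ?_,
    fun z => prob_le_one, fun A hA => ?_⟩
  · have h := hv j
    -- This is `(1 - c j) * (z' - z) ≥ 0`.
    have h1 : c j * z' + (z - c j * z) ≤ z' := by nlinarith [hc j]
    simp only at h ⊢
    exact ⟨fun hj => by linarith [h.1 hj], by linarith [h.2]⟩
  · have hset : {ω | Y i ω ∈ A ∧ (fun j => Y j ω) ∈ argmaxSet i}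
        = (fun ω => (Y i ω, V ω)) ⁻¹' ((A ×ˢ Set.univ) ∩ S) := by
      ext ω
      simp [S, V, argmaxSet]
    rw [hset, ← Measure.map_apply_of_aemeasurable ((hYm i).prodMk hV)
      ((hA.prod MeasurableSet.univ).inter hS), hmap,
      Measure.prod_apply ((hA.prod MeasurableSet.univ).inter hS), ← lintegral_indicator hA]
    refine lintegral_congr fun z => ?_
    by_cases hz : z ∈ A
    · rw [Set.indicator_of_mem hz]
      congr 1
      ext v
      simp [hz]
    · rw [Set.indicator_of_notMem hz]
      simp [Set.preimage, hz]

end Density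

/-! ### Anti-concentration -/

/-- Anti-concentration for the maximum of a jointly Gaussian family of standard Gaussian
variables. -/
lemma HasGaussianLaw.measure_exists_lt_forall_le_le {Ω ι : Type*} [MeasurableSpace Ω]
    {P : Measure Ω} [IsProbabilityMeasure P] [Fintype ι] [Nonempty ι] {Y : ι → Ω → ℝ}
    (hX : HasGaussianLaw (fun ω i => Y i ω) P)
    (hY : ∀ i, HasLaw (Y i) (gaussianReal 0 1) P) (a b : ℝ) :
    P {ω | (∃ i, a < Y i ω) ∧ ∀ i, Y i ω ≤ b}
      ≤ ENNReal.ofReal (Real.sqrt (2 * Real.log (Fintype.card ι)) + 1)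
        * ENNReal.ofReal (b - a) := by
  -- An arbitrary order breaks ties, which a singular covariance can make likely.
  let _ : LinearOrder ι := LinearOrder.lift' (Fintype.equivFin ι) (Fintype.equivFin ι).injective
  choose G hmono hle hG using HasGaussianLaw.exists_monotone_density_argmaxSet hX hY
  have hmeas : ∀ i, Measurable (G i) := fun i => (hmono i).measurable
  have hsum : ∫⁻ z, ∑ i, G i z ∂(gaussianReal 0 1) ≤ 1 := by
    rw [lintegral_finsetSum _ fun i _ => hmeas i]
    have h : ∀ i, ∫⁻ z, G i z ∂(gaussianReal 0 1)
        = P ((fun ω j => Y j ω) ⁻¹' argmaxSet i) := fun i => by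
      have := hG i Set.univ MeasurableSet.univ
      simp only [Set.mem_univ, true_and, Measure.restrict_univ] at this
      exact this.symm
    simp only [h]
    have hYm : AEMeasurable (fun ω j => Y j ω) P := hX.aemeasurable
    rw [← tsum_fintype (L := SummationFilter.unconditional ι), ← measure_iUnion₀]
    · exact prob_le_one
    · intro i j hij
      exact ((pairwise_disjoint_argmaxSet hij).preimage _).aedisjoint
    · exact fun i => hYm.nullMeasurableSet_preimage (measurableSet_argmaxSet i)
  calc P {ω | (∃ i, a < Y i ω) ∧ ∀ i, Y i ω ≤ b}
      ≤ P (⋃ i, {ω | Y i ω ∈ Set.Ioc a b ∧ (fun j => Y j ω) ∈ argmaxSet i}) := by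
        refine measure_mono ?_
        rintro ω ⟨⟨k, hk⟩, hb⟩
        obtain ⟨i, hi⟩ := exists_mem_argmaxSet fun j => Y j ω
        exact Set.mem_iUnion.2 ⟨i, ⟨hk.trans_le (hi k).2, hb i⟩, hi⟩
    _ ≤ ∑ i, P {ω | Y i ω ∈ Set.Ioc a b ∧ (fun j => Y j ω) ∈ argmaxSet i} :=
        measure_iUnion_fintype_le P _
    _ = ∫⁻ z in Set.Ioc a b, ∑ i, G i z ∂(gaussianReal 0 1) := by
        rw [lintegral_finsetSum _ fun i _ => hmeas i]
        exact Finset.sum_congr rfl fun i _ => hG i _ measurableSet_Ioc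
    _ ≤ _ := by
        refine setLIntegral_Ioc_gaussianReal_le_of_monotone
          (fun z z' h => Finset.sum_le_sum fun i _ => hmono i h) Fintype.card_ne_zero
          (fun z => ?_) hsum a b
        calc ∑ i, G i z ≤ ∑ _i : ι, 1 := Finset.sum_le_sum fun i _ => hle i z
          _ = Fintype.card ι := by simp

/-- Anti-concentration for the maximum of a jointly Gaussian family with common variance. -/
lemma HasGaussianLaw.measureReal_exists_lt_forall_le_le {Ω ι : Type*} [MeasurableSpace Ω]
    {P : Measure Ω} [IsProbabilityMeasure P] [Fintype ι] [Nonempty ι] {X : ι → Ω → ℝ} {σ : ℝ}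
    (hσ : 0 < σ) (hX : HasGaussianLaw (fun ω i => X i ω) P)
    (hlaw : ∀ i, HasLaw (X i) (gaussianReal 0 (σ ^ 2).toNNReal) P) (x : ℝ) {ε : ℝ} (hε : 0 ≤ ε) :
    P.real {ω | (∃ i, x < X i ω) ∧ ∀ i, X i ω ≤ x + ε}
      ≤ ε / σ * (Real.sqrt (2 * Real.log (Fintype.card ι)) + 1) := by
  have hG : HasGaussianLaw (fun ω i => X i ω / σ) P := by
    convert! hX.fun_smul σ⁻¹ using 3
    simp [div_eq_inv_mul]
  have hY : ∀ i, HasLaw (fun ω => X i ω / σ) (gaussianReal 0 1) P := fun i => by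
    convert! gaussianReal_div_const (hlaw i) σ using 2
    · simp
    · ext
      simp [hσ.ne', sq_nonneg]
  have h := HasGaussianLaw.measure_exists_lt_forall_le_le hG hY (x / σ) ((x + ε) / σ)
  have hset : {ω | (∃ i, x / σ < X i ω / σ) ∧ ∀ i, X i ω / σ ≤ (x + ε) / σ}
      = {ω | (∃ i, x < X i ω) ∧ ∀ i, X i ω ≤ x + ε} := by
    simp only [div_lt_div_iff_of_pos_right hσ, div_le_div_iff_of_pos_right hσ]
  have hC : 0 ≤ Real.sqrt (2 * Real.log (Fintype.card ι)) + 1 := by positivity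
  rw [hset, ← sub_div, add_sub_cancel_left, ← ENNReal.ofReal_mul hC, mul_comm] at h
  exact ENNReal.toReal_le_of_le_ofReal (by positivity) h

theorem mainTheorem6 {Ω : Type*} [MeasurableSpace Ω] (P : Measure Ω) [IsProbabilityMeasure P]
    (d : ℕ) [NeZero d] (μ σ : ℝ) (hσ : 0 < σ) (X : Fin d → Ω → ℝ)
    (hX : HasGaussianLaw (fun ω i => X i ω) P)
    (hmarg : ∀ i, HasLaw (X i) (gaussianReal μ (σ ^ 2).toNNReal) P)
    (x ε : ℝ) (hε : 0 ≤ ε) :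
    P.real {ω | x < Finset.univ.sup' Finset.univ_nonempty (fun i => X i ω) ∧
        Finset.univ.sup' Finset.univ_nonempty (fun i => X i ω) ≤ x + ε}
      ≤ ε / σ * (Real.sqrt (2 * Real.log (d : ℝ)) + 1) ∧
    P.real {ω | x < Finset.univ.sup' Finset.univ_nonempty (fun i => |X i ω - μ|) ∧
        Finset.univ.sup' Finset.univ_nonempty (fun i => |X i ω - μ|) ≤ x + ε}
      ≤ ε / σ * (Real.sqrt (2 * Real.log (2 * (d : ℝ))) + 1) := by
  have hlaw : ∀ i, HasLaw (fun ω => X i ω - μ) (gaussianReal 0 (σ ^ 2).toNNReal) P := fun i => by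
    simpa using gaussianReal_sub_const (hmarg i) μ
  have hG : HasGaussianLaw (fun ω i => X i ω - μ) P := by
    have := hX.isGaussian_map
    refine ⟨?_⟩
    have h : P.map (fun ω i => X i ω - μ)
        = (P.map fun ω i => X i ω).map (fun y => y + fun _ => -μ) := by
      rw [AEMeasurable.map_map_of_aemeasurable (by fun_prop) hX.aemeasurable]
      rfl
    rw [h]
    infer_instance
  constructor
  · have h := HasGaussianLaw.measureReal_exists_lt_forall_le_le hσ hG hlaw (x - μ) hε
    rw [Fintype.card_fin] at h
    refine le_of_eq_of_le ?_ h
    congr 1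
    ext ω
    simp [Finset.lt_sup'_iff, Finset.sup'_le_iff, sub_add_eq_add_sub]
  · let s : Bool → ℝ := fun b => if b then 1 else -1
    let L : (Fin d → ℝ) →L[ℝ] (Fin d × Bool → ℝ) :=
      ContinuousLinearMap.pi fun p => s p.2 • ContinuousLinearMap.proj p.1
    have hG2 : HasGaussianLaw (fun ω (p : Fin d × Bool) => s p.2 * (X p.1 ω - μ)) P := hG.map_fun L
    have hlaw2 : ∀ p : Fin d × Bool, HasLaw (fun ω => s p.2 * (X p.1 ω - μ))
        (gaussianReal 0 (σ ^ 2).toNNReal) P := by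
      rintro ⟨i, b⟩
      cases b
      · simpa [s, -neg_sub] using! gaussianReal_neg (hlaw i)
      · simpa [s] using hlaw i
    have h := HasGaussianLaw.measureReal_exists_lt_forall_le_le hσ hG2 hlaw2 x hε
    have hcard : ((Fintype.card (Fin d × Bool) : ℕ) : ℝ) = 2 * d := by
      simp [mul_comm]
    rw [hcard] at h
    refine le_of_eq_of_le ?_ h
    congr 1
    ext ω
    simp [Finset.lt_sup'_iff, Finset.sup'_le_iff, s, lt_abs, abs_le', or_comm, and_comm,
      -neg_sub]
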